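/- Let $(\Omega,\mathcal F,\mu)$ be a probability space and let $T:\Omega\to\Omega$ be a bijective, bi-measurable, measure-preserving map. For $f:\Omega\to\mathbb R$ and $n\ge 1$ write $S_n(f)=\sum_{j=0}^{n-1} f\circ T^j$. Let $1\le q<p<r<2$ be real numbers with $q\ge (p-1)r/(r-1)$, and let $g:\Omega\to\mathbb R$ be a function such that $g\in\mathbb L^q(\mu)$ and $g-g\circ T\in\mathbb L^r(\mu)$. Let $m\in\mathbb L^p(\mu)$ be such that $(m\circ T^i)_{i\ge 0}$ is a martingale difference sequence, i.e. there is a filtration $(\mathcal F_i)_{i\ge 0}$ in $\mathcal F$ such that $m\circ T^i$ is integrable and $\mathcal F_i$-measurable and $\mathbb E[m\circ T^{i+1}\mid\mathcal F_i]=0$ almost surely, for every $i\ge 0$. Then the function $f:=m+g-g\circ T$ satisfies the $p$-strong law of large numbers: for every $\alpha\in[1/p,1]$ and every $\varepsilon>0$, $$\sum_{n=1}^{+\infty} n^{\alpha p-2}\,\mu\Big\{\max_{1\le k\le n}|S_k(f)|\ge \varepsilon n^{\alpha}\Big\}<+\infty .$$ -/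

import Mathlib

open MeasureTheory

/-- The real random variables `X 0, X 1, …` form a martingale difference sequence: for some
filtration `ℱ`, each `X i` is integrable and `ℱ i`-measurable, and `𝔼[X (i + 1) | ℱ i] = 0`
almost surely. -/
def IsMartingaleDifferenceSeq {Ω : Type*} [mΩ : MeasurableSpace Ω] (μ : Measure Ω)
    (X : ℕ → Ω → ℝ) : Prop :=
  ∃ ℱ : Filtration ℕ mΩ,
    Adapted ℱ X ∧
    (∀ i, Integrable (X i) μ) ∧
    ∀ i, μ[X (i + 1) | ℱ i] =ᵐ[μ] 0

/-- `max_{1 ≤ k ≤ n} |S_k(f)(ω)|`, where `S_k(f) = ∑_{j < k} f ∘ T^j` (`birkhoffSum T f k`).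
The maximum is formed in `ℝ≥0`. -/
noncomputable def maxAbsPartialSum {Ω : Type*} (T : Ω → Ω) (f : Ω → ℝ) (n : ℕ) (ω : Ω) : ℝ :=
  ((Finset.Icc 1 n).sup fun k => ‖birkhoffSum T f k ω‖₊ : NNReal)

/-- The `p`-strong law of large numbers for `f`: for all `α ∈ [1/p, 1]` and `ε > 0`,
`∑_{n ≥ 1} n^{αp - 2} μ {max_{1 ≤ k ≤ n} |S_k(f)| ≥ ε n^α} < ∞`
(the terms are nonnegative, and the index `n` below stands for `n + 1`). -/
def SatisfiesPStrongLaw {Ω : Type*} [MeasurableSpace Ω] (μ : Measure Ω) (T : Ω → Ω) (p : ℝ)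
    (f : Ω → ℝ) : Prop :=
  ∀ α ∈ Set.Icc (1 / p) 1, ∀ ε : ℝ, 0 < ε →
    Summable fun n : ℕ =>
      ((n + 1 : ℕ) : ℝ) ^ (α * p - 2) *
        μ.real {ω | ε * ((n + 1 : ℕ) : ℝ) ^ α ≤ maxAbsPartialSum T f (n + 1) ω}

/-!
The partial sums of `f = m + g - g ∘ T` are `S_k(m) + g - g ∘ T^k`, so the martingale part and the
values of `g` along the orbit can be treated separately. In both cases the series over `n` is
exchanged with an integral, and for fixed `ω` it becomes a power sum over an initial or a final
segment of the indices (`tsum_mul_lintegral_upper_ne_top`, `tsum_mul_lintegral_lower_ne_top`).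

For the martingale part, the differences `m ∘ T^i`, `i < n`, are truncated at height `n ^ α` and
recentred. Kolmogorov's inequality, that is, Doob's inequality for the submartingale of squares,
bounds the truncated part by a second moment. The remainder is bounded in `L¹`. Summed over `n`,
either bound is a multiple of `𝔼|m|^p` (`tsum_measure_martingale_ne_top`).

For the orbit of `g`, let `h = g - g ∘ T` and suppose that `|g ∘ T^k| ≥ 2 l` for some `k ≤ n`, where
`l` is of order `n ^ α`. Over a window of `L` steps the increments `|h ∘ T^j|` smaller than
`l / (2 L)` change `g` by at most `l / 2`. Therefore either `|g ∘ T^j| ≥ l` for all `j` in the window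
`[k, k + L)`, or the larger increments add up to at least `l / 2`
(`card_window_le_or_le_sum_increments`). Markov's inequality makes the first case a factor `L` rarer
than the union bound does, and bounds the second by the tail of the first moment of `|h|` above
`l / (2 L)`. With `L ≈ n ^ (α (p - q))` the first series is controlled by `𝔼|g|^q`, the second by
`𝔼|h|^s` with `s = 1 + (p - 1) / (1 - p + q)`, and the assumption `q ≥ (p - 1) r / (r - 1)` is
equivalent to `s ≤ r` (`tsum_measure_iterate_ne_top`).
-/

/-! ### Power sums over initial and final segments -/

/-- Discrete counterpart of `∫_x^{x+1} a t^(a-1) dt = (x+1)^a - x^a`. -/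
lemma min_one_mul_rpow_sub_one_le {a x : ℝ} (ha : 0 < a) (hx : 0 ≤ x) :
    min a 1 * (x + 1) ^ (a - 1) ≤ (x + 1) ^ a - x ^ a := by
  have hx1 : 0 < x + 1 := by linarith
  have e : (x + 1) ^ a = (x + 1) ^ (a - 1) * (x + 1) := by
    rw [Real.rpow_sub_one hx1.ne']; field_simp
  have hp : 0 ≤ (x + 1) ^ (a - 1) := by positivity
  -- It suffices to bound the ratio `(x / (x + 1)) ^ a`.
  have key : (x / (x + 1)) ^ a ≤ 1 - min a 1 / (x + 1) := by
    have h0 : 0 ≤ x / (x + 1) := by positivity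
    have h1 : x / (x + 1) = 1 + -(1 / (x + 1)) := by field_simp; ring
    rcases le_total a 1 with h | h
    · rw [min_eq_left h, h1]
      have hs : -1 ≤ -(1 / (x + 1)) := by
        rw [neg_le_neg_iff, div_le_one hx1]; linarith
      refine (rpow_one_add_le_one_add_mul_self hs ha.le h).trans (le_of_eq ?_)
      ring
    · rw [min_eq_right h]
      have : x / (x + 1) ≤ 1 := by rw [div_le_one hx1]; linarith
      refine (Real.rpow_le_rpow_of_exponent_ge_of_imp h0 this h ?_).trans (le_of_eq ?_)
      · intro _ h'; linarith
      · rw [Real.rpow_one, h1]; ring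
  have h2 : x ^ a = (x + 1) ^ a * (x / (x + 1)) ^ a := by
    rw [Real.div_rpow hx hx1.le]; field_simp
  have h3 : (x + 1) ^ a * (x / (x + 1)) ^ a ≤ (x + 1) ^ a * (1 - min a 1 / (x + 1)) := by
    gcongr
  have h4 : (x + 1) ^ a * (1 - min a 1 / (x + 1)) = (x + 1) ^ a - min a 1 * (x + 1) ^ (a - 1) := by
    rw [e]; field_simp
  linarith

/-- Discrete counterpart of `∫_x^{x+1} a t^(-a-1) dt = x^(-a) - (x+1)^(-a)`. -/
lemma rpow_neg_sub_one_le {a x : ℝ} (ha : 0 < a) (ha1 : a ≤ 1) (hx : 1 ≤ x) :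
    a / 2 * x ^ (-a - 1) ≤ x ^ (-a) - (x + 1) ^ (-a) := by
  have hx0 : 0 < x := by linarith
  have h := min_one_mul_rpow_sub_one_le ha hx0.le
  rw [min_eq_left ha1, Real.rpow_sub_one (by positivity)] at h
  rw [Real.rpow_sub_one hx0.ne', Real.rpow_neg hx0.le, Real.rpow_neg (by positivity)]
  have hu : 0 < x ^ a := by positivity
  have hv : 0 < (x + 1) ^ a := by positivity
  set u := x ^ a
  set v := (x + 1) ^ a
  have e : u⁻¹ - v⁻¹ = (v - u) / (u * v) := by field_simp
  have h' : a * (v / (x + 1)) / (u * v) ≤ (v - u) / (u * v) := by gcongr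
  have h'' : a * (v / (x + 1)) / (u * v) = a / (x + 1) * u⁻¹ := by field_simp
  have h3 : a / 2 * (u⁻¹ / x) ≤ a / (x + 1) * u⁻¹ := by
    have : a / 2 * (u⁻¹ / x) = a / (2 * x) * u⁻¹ := by field_simp
    rw [this]; gcongr; linarith
  linarith

lemma rpow_add_one_sub {N : ℝ} (hN : 0 < N) (s t : ℝ) :
    N ^ (s + 1 - t) = N ^ s * N / N ^ t := by
  rw [Real.rpow_sub hN, Real.rpow_add_one hN.ne']

lemma tsum_rpow_le_of_le {a y : ℝ} (ha : 0 < a) (hy : 0 ≤ y) :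
    ∑' n : ℕ, ENNReal.ofReal (if (n : ℝ) + 1 ≤ y then ((n : ℝ) + 1) ^ (a - 1) else 0) ≤
      ENNReal.ofReal ((min a 1)⁻¹ * y ^ a) := by
  have hm : 0 < min a 1 := by positivity
  refine ENNReal.tsum_le_of_sum_range_le fun M => ?_
  rw [← ENNReal.ofReal_sum_of_nonneg (fun i _ => by split_ifs <;> positivity)]
  refine ENNReal.ofReal_le_ofReal ?_
  have key : ∀ M : ℕ, ∑ n ∈ Finset.range M,
      (if (n : ℝ) + 1 ≤ y then ((n : ℝ) + 1) ^ (a - 1) else 0) ≤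
        (min a 1)⁻¹ * (min y M) ^ a := by
    intro M
    induction M with
    | zero => simp [hy, Real.zero_rpow ha.ne']
    | succ M ih =>
      rw [Finset.sum_range_succ]
      split_ifs with h
      · have h1 := min_one_mul_rpow_sub_one_le ha (Nat.cast_nonneg (α := ℝ) M)
        rw [min_eq_right (show (M : ℝ) ≤ y by linarith)] at ih
        rw [Nat.cast_succ, min_eq_right h]
        rw [← le_div_iff₀' hm, div_eq_inv_mul] at h1
        linarith
      · rw [add_zero]
        refine ih.trans ?_
        gcongr
        simp
  refine (key M).trans ?_
  gcongr
  exact min_le_left _ _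

lemma tsum_rpow_le_of_ge {a y : ℝ} (ha : 0 < a) (ha1 : a ≤ 1) (hy : 0 < y) :
    ∑' n : ℕ, ENNReal.ofReal (if y ≤ (n : ℝ) + 1 then ((n : ℝ) + 1) ^ (-a - 1) else 0) ≤
      ENNReal.ofReal (2 / a * y ^ (-a)) := by
  refine ENNReal.tsum_le_of_sum_range_le fun M => ?_
  rw [← ENNReal.ofReal_sum_of_nonneg (fun i _ => by split_ifs <;> positivity)]
  refine ENNReal.ofReal_le_ofReal ?_
  have key : ∀ M : ℕ, ∑ n ∈ Finset.range M,
      (if y ≤ (n : ℝ) + 1 then ((n : ℝ) + 1) ^ (-a - 1) else 0) ≤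
        2 / a * (y ^ (-a) - (max y (M + 1)) ^ (-a)) := by
    intro M
    induction M with
    | zero =>
      simp only [Finset.range_zero, Finset.sum_empty]
      have := Real.rpow_le_rpow_of_nonpos hy (le_max_left y (((0 : ℕ) : ℝ) + 1))
        (neg_nonpos.2 ha.le)
      have := sub_nonneg.2 this
      positivity
    | succ M ih =>
      rw [Finset.sum_range_succ]
      split_ifs with h
      · have h1 := rpow_neg_sub_one_le ha ha1 (x := (M : ℝ) + 1) (by simp)
        rw [max_eq_right h] at ih
        rw [Nat.cast_succ, max_eq_right (by linarith)]
        have h2 : ((M : ℝ) + 1) ^ (-a - 1) ≤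
            2 / a * (((M : ℝ) + 1) ^ (-a) - ((M : ℝ) + 1 + 1) ^ (-a)) := by
          have : 0 < 2 / a := by positivity
          calc _ = 2 / a * (a / 2 * ((M : ℝ) + 1) ^ (-a - 1)) := by field_simp
            _ ≤ _ := by gcongr
        linarith
      · rw [add_zero]
        refine ih.trans ?_
        have := Real.rpow_le_rpow_of_nonpos (x := max y ((M : ℝ) + 1))
          (y := max y (((M + 1 : ℕ) : ℝ) + 1)) (by positivity)
          (by gcongr; simp) (neg_nonpos.2 ha.le)
        gcongr
  refine (key M).trans ?_
  gcongr
  have : 0 ≤ (max y ((M : ℝ) + 1)) ^ (-a) := by positivity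
  linarith

/-! ### Sums of truncated moments -/

section Moments

variable {Ω : Type*} [MeasurableSpace Ω] {μ : Measure Ω} [IsProbabilityMeasure μ] {X : Ω → ℝ}

lemma lintegral_abs_rpow_ne_top {s t : ℝ} (ht : 0 < t) (hts : t ≤ s)
    (hX : MemLp X (ENNReal.ofReal s) μ) : ∫⁻ ω, ENNReal.ofReal (|X ω| ^ t) ∂μ ≠ ⊤ := by
  have h1 : MemLp X (ENNReal.ofReal t) μ := hX.mono_exponent (ENNReal.ofReal_le_ofReal hts)
  have h2 := h1.integrable_norm_rpow (by simpa using ht) ENNReal.ofReal_ne_top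
  rw [ENNReal.toReal_ofReal ht.le] at h2
  exact h2.lintegral_lt_top.ne

/-- The sum is exchanged with the integral; for fixed `x = |X ω|` only the indices
`n + 1 ≤ (x / c) ^ (1 / γ)` contribute, so that the sum is of order `x ^ (b + a / γ)`. -/
lemma tsum_mul_lintegral_upper_ne_top {a b c γ s : ℝ} (ha : 0 < a) (hb : 0 ≤ b) (hc : 0 < c)
    (hγ : 0 < γ) (hs : b + a / γ ≤ s) (hX : MemLp X (ENNReal.ofReal s) μ) :
    ∑' n : ℕ, ENNReal.ofReal (((n : ℝ) + 1) ^ (a - 1)) *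
      ∫⁻ ω, ENNReal.ofReal (if c * ((n : ℝ) + 1) ^ γ ≤ |X ω| then |X ω| ^ b else 0) ∂μ ≠ ⊤ := by
  have hXm : AEMeasurable X μ := hX.aemeasurable
  have hmeas : ∀ n : ℕ, AEMeasurable
      (fun ω => ENNReal.ofReal (if c * ((n : ℝ) + 1) ^ γ ≤ |X ω| then |X ω| ^ b else 0)) μ := by
    intro n
    have : Measurable fun x : ℝ =>
        ENNReal.ofReal (if c * ((n : ℝ) + 1) ^ γ ≤ |x| then |x| ^ b else 0) :=
      (Measurable.ite (measurableSet_le measurable_const (by fun_prop)) (by fun_prop)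
        measurable_const).ennreal_ofReal
    exact this.comp_aemeasurable hXm
  simp_rw [← lintegral_const_mul'' _ (hmeas _)]
  rw [← lintegral_tsum fun n => (hmeas n).const_mul _]
  have hfin : ENNReal.ofReal ((min a 1)⁻¹ * c⁻¹ ^ (a / γ)) *
      ∫⁻ ω, ENNReal.ofReal (|X ω| ^ (b + a / γ)) ∂μ ≠ ⊤ :=
    ENNReal.mul_ne_top ENNReal.ofReal_ne_top
      (lintegral_abs_rpow_ne_top (by positivity) hs hX)
  refine ne_top_of_le_ne_top hfin ?_
  rw [← lintegral_const_mul' _ _ ENNReal.ofReal_ne_top]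
  refine lintegral_mono fun ω => ?_
  set x := |X ω| with hx
  have hx0 : 0 ≤ x := abs_nonneg _
  have hterm : ∀ n : ℕ, ENNReal.ofReal (((n : ℝ) + 1) ^ (a - 1)) *
      ENNReal.ofReal (if c * ((n : ℝ) + 1) ^ γ ≤ x then x ^ b else 0) =
      ENNReal.ofReal (x ^ b) * ENNReal.ofReal
        (if (n : ℝ) + 1 ≤ (x / c) ^ γ⁻¹ then ((n : ℝ) + 1) ^ (a - 1) else 0) := by
    intro n
    have : c * ((n : ℝ) + 1) ^ γ ≤ x ↔ (n : ℝ) + 1 ≤ (x / c) ^ γ⁻¹ := by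
      rw [Real.le_rpow_inv_iff_of_pos (by positivity) (by positivity) hγ, le_div_iff₀' hc]
    simp only [this]
    split_ifs <;> simp [mul_comm]
  simp_rw [hterm]
  rw [ENNReal.tsum_mul_left]
  refine (mul_le_mul_right (tsum_rpow_le_of_le ha (y := (x / c) ^ γ⁻¹) (by positivity)) _).trans ?_
  rw [← ENNReal.ofReal_mul (by positivity), ← ENNReal.ofReal_mul (by positivity)]
  refine ENNReal.ofReal_le_ofReal (le_of_eq ?_)
  rw [← Real.rpow_mul (by positivity), div_eq_mul_inv x c, Real.mul_rpow hx0 (by positivity),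
    Real.rpow_add_of_nonneg hx0 hb (by positivity), show γ⁻¹ * a = a / γ by ring]
  ring

/-- Counterpart of `tsum_mul_lintegral_upper_ne_top` for the second moments of truncations. -/
lemma tsum_mul_lintegral_lower_ne_top {a γ s : ℝ} (ha : 0 < a) (ha1 : a ≤ 1)
    (hγ : 0 < γ) (hs0 : 0 < s) (hs : 2 - a / γ = s) (hX : MemLp X (ENNReal.ofReal s) μ) :
    ∑' n : ℕ, ENNReal.ofReal (((n : ℝ) + 1) ^ (-a - 1)) *
      ∫⁻ ω, ENNReal.ofReal (if |X ω| ≤ ((n : ℝ) + 1) ^ γ then X ω ^ 2 else 0) ∂μ ≠ ⊤ := by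
  have hXm : AEMeasurable X μ := hX.aemeasurable
  have hmeas : ∀ n : ℕ, AEMeasurable
      (fun ω => ENNReal.ofReal (if |X ω| ≤ ((n : ℝ) + 1) ^ γ then X ω ^ 2 else 0)) μ := by
    intro n
    have : Measurable fun x : ℝ =>
        ENNReal.ofReal (if |x| ≤ ((n : ℝ) + 1) ^ γ then x ^ 2 else 0) :=
      (Measurable.ite (measurableSet_le (by fun_prop) measurable_const) (by fun_prop)
        measurable_const).ennreal_ofReal
    exact this.comp_aemeasurable hXm
  simp_rw [← lintegral_const_mul'' _ (hmeas _)]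
  rw [← lintegral_tsum fun n => (hmeas n).const_mul _]
  have hfin : ENNReal.ofReal (2 / a) * ∫⁻ ω, ENNReal.ofReal (|X ω| ^ s) ∂μ ≠ ⊤ :=
    ENNReal.mul_ne_top ENNReal.ofReal_ne_top (lintegral_abs_rpow_ne_top hs0 le_rfl hX)
  refine ne_top_of_le_ne_top hfin ?_
  rw [← lintegral_const_mul' _ _ ENNReal.ofReal_ne_top]
  refine lintegral_mono fun ω => ?_
  dsimp only
  rw [← sq_abs (X ω)]
  set x := |X ω| with hx
  rcases (abs_nonneg (X ω)).eq_or_lt' with h0 | hx0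
  · simp [hx, h0]
  rw [← hx] at hx0
  have hterm : ∀ n : ℕ, ENNReal.ofReal (((n : ℝ) + 1) ^ (-a - 1)) *
      ENNReal.ofReal (if x ≤ ((n : ℝ) + 1) ^ γ then x ^ 2 else 0) =
      ENNReal.ofReal (x ^ 2) * ENNReal.ofReal
        (if x ^ γ⁻¹ ≤ (n : ℝ) + 1 then ((n : ℝ) + 1) ^ (-a - 1) else 0) := by
    intro n
    have : x ≤ ((n : ℝ) + 1) ^ γ ↔ x ^ γ⁻¹ ≤ (n : ℝ) + 1 := by
      rw [Real.rpow_inv_le_iff_of_pos (by positivity) (by positivity) hγ]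
    simp only [this]
    split_ifs <;> simp [mul_comm]
  simp_rw [hterm]
  rw [ENNReal.tsum_mul_left]
  refine (mul_le_mul_right (tsum_rpow_le_of_ge ha ha1 (y := x ^ γ⁻¹) (by positivity)) _).trans ?_
  rw [← ENNReal.ofReal_mul (by positivity), ← ENNReal.ofReal_mul (by positivity)]
  refine ENNReal.ofReal_le_ofReal (le_of_eq ?_)
  rw [← Real.rpow_mul (by positivity), ← hs, Real.rpow_sub hx0, Real.rpow_two,
    show γ⁻¹ * -a = -(a / γ) by ring, Real.rpow_neg hx0.le]
  ring

end Moments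

/-! ### Maximal inequalities for martingale differences -/

section Martingale

variable {Ω : Type*} [mΩ : MeasurableSpace Ω] {μ : Measure Ω} {𝒢 : Filtration ℕ mΩ}

lemma memLp_two_sum_range {d : ℕ → Ω → ℝ} (hd2 : ∀ i, MemLp (d i) 2 μ) (n : ℕ) :
    MemLp (fun ω => ∑ i ∈ Finset.range n, d i ω) 2 μ :=
  memLp_finsetSum _ fun i _ => hd2 i

lemma stronglyMeasurable_sum_range {d : ℕ → Ω → ℝ}
    (hd : ∀ i, StronglyMeasurable[𝒢 (i + 1)] (d i)) (n : ℕ) :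
    StronglyMeasurable[𝒢 n] (fun ω => ∑ i ∈ Finset.range n, d i ω) :=
  Finset.stronglyMeasurable_fun_sum _ fun i hi =>
    (hd i).mono (𝒢.mono (Finset.mem_range.1 hi))

lemma integral_abs_sub_condExp_le {m : MeasurableSpace Ω} {Z : Ω → ℝ}
    (hZ : Integrable Z μ) : ∫ ω, |Z ω - (μ[Z | m]) ω| ∂μ ≤ 2 * ∫ ω, |Z ω| ∂μ := by
  have h1 : ∫ ω, |(μ[Z | m]) ω| ∂μ ≤ ∫ ω, |Z ω| ∂μ := integral_abs_condExp_le Z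
  have hc : Integrable (μ[Z | m]) μ := integrable_condExp
  calc ∫ ω, |Z ω - (μ[Z | m]) ω| ∂μ ≤ ∫ ω, (|Z ω| + |(μ[Z | m]) ω|) ∂μ :=
        integral_mono (hZ.sub hc).abs (hZ.abs.add hc.abs) fun ω => abs_sub _ _
    _ = ∫ ω, |Z ω| ∂μ + ∫ ω, |(μ[Z | m]) ω| ∂μ := integral_add hZ.abs hc.abs
    _ ≤ _ := by linarith

variable [IsProbabilityMeasure μ]

/-- A partial sum of martingale differences is orthogonal to the next difference, conditionally on
the past. -/
lemma condExp_sum_range_mul_eq_zero {d : ℕ → Ω → ℝ}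
    (hd : ∀ i, StronglyMeasurable[𝒢 (i + 1)] (d i)) (hd2 : ∀ i, MemLp (d i) 2 μ)
    (hd0 : ∀ i, μ[d i | 𝒢 i] =ᵐ[μ] 0) (n : ℕ) :
    μ[(fun ω => ∑ i ∈ Finset.range n, d i ω) * d n | 𝒢 n] =ᵐ[μ] 0 := by
  have h := condExp_mul_of_stronglyMeasurable_left (μ := μ) (stronglyMeasurable_sum_range hd n)
    ((memLp_two_sum_range hd2 n).integrable_mul (hd2 n))
    ((hd2 n).integrable one_le_two)
  filter_upwards [h, hd0 n] with ω h1 h2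
  rw [h1, Pi.mul_apply, h2]
  simp

lemma integral_sum_range_sq {d : ℕ → Ω → ℝ}
    (hd : ∀ i, StronglyMeasurable[𝒢 (i + 1)] (d i)) (hd2 : ∀ i, MemLp (d i) 2 μ)
    (hd0 : ∀ i, μ[d i | 𝒢 i] =ᵐ[μ] 0) (n : ℕ) :
    ∫ ω, (∑ i ∈ Finset.range n, d i ω) ^ 2 ∂μ = ∑ i ∈ Finset.range n, ∫ ω, d i ω ^ 2 ∂μ := by
  induction n with
  | zero => simp
  | succ n ih =>
    have hS := memLp_two_sum_range hd2 n
    have hc : ∫ ω, (∑ i ∈ Finset.range n, d i ω) * d n ω ∂μ = 0 := by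
      have h := integral_condExp (μ := μ) (𝒢.le n)
        (f := (fun ω => ∑ i ∈ Finset.range n, d i ω) * d n)
      rw [integral_congr_ae (condExp_sum_range_mul_eq_zero hd hd2 hd0 n)] at h
      simpa using h.symm
    have hSd : Integrable (fun ω => (∑ i ∈ Finset.range n, d i ω) * d n ω) μ :=
      hS.integrable_mul (hd2 n)
    have e : ∀ ω, (∑ i ∈ Finset.range (n + 1), d i ω) ^ 2 =
        (∑ i ∈ Finset.range n, d i ω) ^ 2 +
          (2 * ((∑ i ∈ Finset.range n, d i ω) * d n ω) + d n ω ^ 2) := by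
      intro ω; rw [Finset.sum_range_succ]; ring
    simp_rw [e]
    have h2 : Integrable
        (fun ω => 2 * ((∑ i ∈ Finset.range n, d i ω) * d n ω) + d n ω ^ 2) μ :=
      (hSd.const_mul 2).add (hd2 n).integrable_sq
    rw [integral_add hS.integrable_sq h2,
      integral_add (hSd.const_mul 2) (hd2 n).integrable_sq, integral_const_mul, hc, ih,
      Finset.sum_range_succ]
    ring

lemma submartingale_sum_range_sq {d : ℕ → Ω → ℝ}
    (hd : ∀ i, StronglyMeasurable[𝒢 (i + 1)] (d i)) (hd2 : ∀ i, MemLp (d i) 2 μ)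
    (hd0 : ∀ i, μ[d i | 𝒢 i] =ᵐ[μ] 0) :
    Submartingale (fun n ω => (∑ i ∈ Finset.range n, d i ω) ^ 2) 𝒢 μ := by
  refine submartingale_of_condExp_sub_nonneg_nat
    (fun n => (stronglyMeasurable_sum_range hd n).pow 2)
    (fun n => (memLp_two_sum_range hd2 n).integrable_sq) fun n => ?_
  have hSd : Integrable ((fun ω => ∑ i ∈ Finset.range n, d i ω) * d n) μ :=
    (memLp_two_sum_range hd2 n).integrable_mul (hd2 n)
  have e : (fun ω => (∑ i ∈ Finset.range (n + 1), d i ω) ^ 2) -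
      (fun ω => (∑ i ∈ Finset.range n, d i ω) ^ 2) =
      (2 : ℝ) • ((fun ω => ∑ i ∈ Finset.range n, d i ω) * d n) + d n ^ 2 := by
    ext ω
    simp only [Pi.sub_apply, Pi.add_apply, Pi.smul_apply, Pi.mul_apply, Pi.pow_apply,
      Finset.sum_range_succ, smul_eq_mul]
    ring
  rw [e]
  have h1 := condExp_add (hSd.smul (2 : ℝ)) (hd2 n).integrable_sq (𝒢 n)
  have h2 := condExp_smul (μ := μ) (2 : ℝ) ((fun ω => ∑ i ∈ Finset.range n, d i ω) * d n) (𝒢 n)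
  have h3 : 0 ≤ᵐ[μ] μ[d n ^ 2 | 𝒢 n] :=
    condExp_nonneg (Filter.Eventually.of_forall fun ω => sq_nonneg _)
  filter_upwards [h1, h2, h3, condExp_sum_range_mul_eq_zero hd hd2 hd0 n] with ω h1 h2 h3 h4
  have h1' : (μ[(2 : ℝ) • ((fun ω => ∑ i ∈ Finset.range n, d i ω) * d n) + d n ^ 2 | 𝒢 n]) ω =
      _ := h1
  rw [h1', Pi.add_apply, h2, Pi.smul_apply, h4, Pi.zero_apply, smul_zero, zero_add]
  exact h3

/-- **Kolmogorov's maximal inequality** for square integrable martingale differences. -/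
lemma measure_exists_le_abs_sum_range_le {d : ℕ → Ω → ℝ}
    (hd : ∀ i, StronglyMeasurable[𝒢 (i + 1)] (d i)) (hd2 : ∀ i, MemLp (d i) 2 μ)
    (hd0 : ∀ i, μ[d i | 𝒢 i] =ᵐ[μ] 0) {V l : ℝ} (hV : ∀ i, ∫ ω, d i ω ^ 2 ∂μ ≤ V)
    (hl : 0 < l) (n : ℕ) :
    μ {ω | ∃ k ≤ n, l ≤ |∑ i ∈ Finset.range k, d i ω|} ≤ ENNReal.ofReal (n * V / l ^ 2) := by
  have h := maximal_ineq (submartingale_sum_range_sq hd hd2 hd0)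
    (fun k ω => sq_nonneg _) (ε := (l ^ 2).toNNReal) n
  rw [Real.coe_toNNReal _ (sq_nonneg l)] at h
  have hsub : {ω | ∃ k ≤ n, l ≤ |∑ i ∈ Finset.range k, d i ω|} ⊆
      {ω | l ^ 2 ≤ (Finset.range (n + 1)).sup' Finset.nonempty_range_add_one
        fun k => (∑ i ∈ Finset.range k, d i ω) ^ 2} := by
    rintro ω ⟨k, hk, hkl⟩
    simp only [Set.mem_ofPred_eq, Finset.le_sup'_iff, Finset.mem_range]
    refine ⟨k, by lia, ?_⟩
    rw [← sq_abs (Finset.sum _ _)]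
    gcongr
  have hI : ∫ ω, (∑ i ∈ Finset.range n, d i ω) ^ 2 ∂μ ≤ n * V := by
    rw [integral_sum_range_sq hd hd2 hd0]
    refine (Finset.sum_le_sum fun i _ => hV i).trans ?_
    simp
  rw [ENNReal.ofReal_div_of_pos (by positivity), ENNReal.le_div_iff_mul_le
    (by left; simpa using hl.ne') (by left; exact ENNReal.ofReal_ne_top), mul_comm]
  calc ENNReal.ofReal (l ^ 2) * μ _ ≤ ENNReal.ofReal (l ^ 2) * μ _ := by gcongr
    _ ≤ _ := h
    _ ≤ ENNReal.ofReal (∫ ω, (∑ i ∈ Finset.range n, d i ω) ^ 2 ∂μ) := by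
      refine ENNReal.ofReal_le_ofReal (setIntegral_le_integral
        (memLp_two_sum_range hd2 n).integrable_sq (Filter.Eventually.of_forall fun ω => ?_))
      exact sq_nonneg _
    _ ≤ _ := ENNReal.ofReal_le_ofReal hI

lemma integral_sub_condExp_sq_le {m : MeasurableSpace Ω} (hm : m ≤ mΩ) {Y : Ω → ℝ}
    (hY : MemLp Y 2 μ) : ∫ ω, (Y ω - (μ[Y | m]) ω) ^ 2 ∂μ ≤ ∫ ω, Y ω ^ 2 ∂μ := by
  have h1 : ∫ ω, (ProbabilityTheory.condVar m Y μ) ω ∂μ = ∫ ω, (Y ω - (μ[Y | m]) ω) ^ 2 ∂μ :=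
    integral_condExp hm
  have h2 : ∫ ω, (μ[Y ^ 2 | m]) ω ∂μ = ∫ ω, Y ω ^ 2 ∂μ := integral_condExp hm
  rw [← h1, ← h2]
  exact integral_mono_ae ProbabilityTheory.integrable_condVar integrable_condExp
    (ProbabilityTheory.condVar_ae_le_condExp_sq hm hY)

/-- Each difference is truncated at height `K` and recentred. The truncated differences are
controlled in `L²` by Kolmogorov's inequality, the remainders in `L¹` by Markov's inequality. -/
lemma measure_exists_two_mul_le_abs_sum_range_le {X : ℕ → Ω → ℝ}
    (hX : ∀ i, StronglyMeasurable[𝒢 (i + 1)] (X i)) (hXi : ∀ i, Integrable (X i) μ)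
    (hX0 : ∀ i, μ[X i | 𝒢 i] =ᵐ[μ] 0) {K V W l : ℝ} (hl : 0 < l)
    (hV : ∀ i, ∫ ω, (if |X i ω| ≤ K then X i ω ^ 2 else 0) ∂μ ≤ V)
    (hW : ∀ i, ∫ ω, (if |X i ω| ≤ K then 0 else |X i ω|) ∂μ ≤ W) (n : ℕ) :
    μ {ω | ∃ k ≤ n, 2 * l ≤ |∑ i ∈ Finset.range k, X i ω|} ≤
      ENNReal.ofReal (n * V / l ^ 2) + ENNReal.ofReal (n * (2 * W) / l) := by
  let Y : ℕ → Ω → ℝ := fun i ω => if |X i ω| ≤ K then X i ω else 0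
  let Z : ℕ → Ω → ℝ := fun i ω => if |X i ω| ≤ K then 0 else X i ω
  let d : ℕ → Ω → ℝ := fun i ω => Y i ω - (μ[Y i | 𝒢 i]) ω
  let e : ℕ → Ω → ℝ := fun i ω => Z i ω - (μ[Z i | 𝒢 i]) ω
  have hYs : ∀ i, StronglyMeasurable[𝒢 (i + 1)] (Y i) := fun i =>
    StronglyMeasurable.ite ((hX i).norm.measurableSet_le stronglyMeasurable_const) (hX i)
      stronglyMeasurable_const
  have hYm : ∀ i, AEStronglyMeasurable (Y i) μ := fun i =>
    ((hYs i).mono (𝒢.le _)).aestronglyMeasurable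
  have hYK : ∀ i ω, ‖Y i ω‖ ≤ |K| := by
    intro i ω
    simp only [Y, Real.norm_eq_abs]
    split_ifs with h
    · exact h.trans (le_abs_self K)
    · simp
  have hY2 : ∀ i, MemLp (Y i) 2 μ := fun i =>
    MemLp.of_bound (hYm i) |K| (Filter.Eventually.of_forall (hYK i))
  have hYi : ∀ i, Integrable (Y i) μ := fun i => (hY2 i).integrable one_le_two
  have hXYZ : ∀ i, X i = Y i + Z i := by
    intro i; ext ω; simp only [Y, Z, Pi.add_apply]; split_ifs <;> simp
  have hZi : ∀ i, Integrable (Z i) μ := by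
    intro i
    have : Z i = X i - Y i := by rw [hXYZ i]; simp
    rw [this]; exact (hXi i).sub (hYi i)
  have hde : ∀ᵐ ω ∂μ, ∀ i, X i ω = d i ω + e i ω := by
    rw [ae_all_iff]
    intro i
    have h1 := condExp_add (hYi i) (hZi i) (𝒢 i)
    rw [← hXYZ i] at h1
    filter_upwards [h1, hX0 i] with ω h1 h2
    rw [h2, Pi.add_apply] at h1
    have h3 : X i ω = Y i ω + Z i ω := congrFun (hXYZ i) ω
    simp only [d, e, Pi.zero_apply] at h1 ⊢
    linarith
  have hei : ∀ i, Integrable (e i) μ := fun i => (hZi i).sub integrable_condExp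
  have hsub : ∀ᵐ ω ∂μ, ω ∈ {ω | ∃ k ≤ n, 2 * l ≤ |∑ i ∈ Finset.range k, X i ω|} →
      ω ∈ {ω | ∃ k ≤ n, l ≤ |∑ i ∈ Finset.range k, d i ω|} ∪
        {ω | l ≤ ∑ i ∈ Finset.range n, |e i ω|} := by
    filter_upwards [hde] with ω hω
    rintro ⟨k, hk, hkl⟩
    by_contra hcon
    simp only [Set.mem_union, Set.mem_ofPred_eq, not_or, not_exists, not_and, not_le] at hcon
    obtain ⟨h1, h2⟩ := hcon
    have h3 := h1 k hk
    have h4 : |∑ i ∈ Finset.range k, e i ω| ≤ ∑ i ∈ Finset.range n, |e i ω| :=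
      (Finset.abs_sum_le_sum_abs _ _).trans (Finset.sum_le_sum_of_subset_of_nonneg
        (Finset.range_mono hk) fun _ _ _ => abs_nonneg _)
    have h5 : ∑ i ∈ Finset.range k, X i ω =
        ∑ i ∈ Finset.range k, d i ω + ∑ i ∈ Finset.range k, e i ω := by
      rw [← Finset.sum_add_distrib]; exact Finset.sum_congr rfl fun i _ => hω i
    rw [h5] at hkl
    have := abs_add_le (∑ i ∈ Finset.range k, d i ω) (∑ i ∈ Finset.range k, e i ω)
    linarith
  refine (measure_mono_ae hsub).trans ((measure_union_le _ _).trans (add_le_add ?_ ?_))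
  · refine measure_exists_le_abs_sum_range_le (𝒢 := 𝒢) (fun i => ?_) (fun i => ?_) (fun i => ?_)
      (fun i => ?_) hl n
    · exact (hYs i).sub (stronglyMeasurable_condExp.mono (𝒢.mono (Nat.le_succ i)))
    · exact (hY2 i).sub ((hY2 i).condExp one_le_two)
    · have h1 := condExp_sub (hYi i) (integrable_condExp (μ := μ) (m := 𝒢 i) (f := Y i)) (𝒢 i)
      have h2 := condExp_of_stronglyMeasurable (𝒢.le i) (stronglyMeasurable_condExp (f := Y i))
        (integrable_condExp (μ := μ))
      rw [h2, sub_self] at h1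
      exact h1
    · refine (integral_sub_condExp_sq_le (𝒢.le i) (hY2 i)).trans ((le_of_eq ?_).trans (hV i))
      refine integral_congr_ae (Filter.Eventually.of_forall fun ω => ?_)
      simp only [Y]; split_ifs <;> simp
  · have hei' : Integrable (fun ω => ∑ i ∈ Finset.range n, |e i ω|) μ :=
      integrable_finsetSum _ fun i _ => (hei i).abs
    have h1 := mul_meas_ge_le_integral_of_nonneg (μ := μ)
      (f := fun ω => ∑ i ∈ Finset.range n, |e i ω|)
      (Filter.Eventually.of_forall fun ω => Finset.sum_nonneg fun i _ => abs_nonneg _) hei' l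
    have h2 : ∫ ω, ∑ i ∈ Finset.range n, |e i ω| ∂μ ≤ n * (2 * W) := by
      rw [integral_finsetSum _ fun i _ => (hei i).abs]
      have : ∀ i ∈ Finset.range n, ∫ ω, |e i ω| ∂μ ≤ 2 * W := by
        intro i _
        refine (integral_abs_sub_condExp_le (hZi i)).trans ?_
        gcongr
        refine (le_of_eq ?_).trans (hW i)
        refine integral_congr_ae (Filter.Eventually.of_forall fun ω => ?_)
        simp only [Z]; split_ifs <;> simp
      refine (Finset.sum_le_sum this).trans ?_
      simp
    rw [← ofReal_measureReal]
    refine ENNReal.ofReal_le_ofReal ?_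
    rw [le_div_iff₀' hl]
    exact h1.trans h2

end Martingale

/-! ### The strong law for stationary martingale differences -/

section Stationary

variable {Ω : Type*} [mΩ : MeasurableSpace Ω] {μ : Measure Ω} [IsProbabilityMeasure μ]

/-- Prepending the trivial `σ`-algebra to the filtration makes every term, including the first one,
a centred increment: `X 0` has mean zero because it has the same mean as `X 1`. -/
lemma IsMartingaleDifferenceSeq.exists_shifted_filtration {X : ℕ → Ω → ℝ}
    (hX : IsMartingaleDifferenceSeq μ X) (hmean : ∫ ω, X 0 ω ∂μ = ∫ ω, X 1 ω ∂μ) :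
    ∃ 𝒢 : Filtration ℕ mΩ, (∀ i, StronglyMeasurable[𝒢 (i + 1)] (X i)) ∧
      ∀ i, μ[X i | 𝒢 i] =ᵐ[μ] 0 := by
  obtain ⟨ℱ, had, -, h0⟩ := hX
  let 𝒢 : Filtration ℕ mΩ :=
    { seq := fun i => Nat.casesOn i ⊥ fun j => ℱ j
      mono' := by
        refine monotone_nat_of_le_succ fun i => ?_
        cases i with
        | zero => exact bot_le
        | succ j => exact ℱ.mono (Nat.le_succ j)
      le' := by
        intro i
        cases i with
        | zero => exact bot_le
        | succ j => exact ℱ.le j }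
  refine ⟨𝒢, fun i => (had i).stronglyMeasurable, fun i => ?_⟩
  cases i with
  | zero =>
    have h1 : ∫ ω, X 1 ω ∂μ = 0 := by
      rw [← integral_condExp (ℱ.le 0), integral_congr_ae (h0 0)]
      simp
    have h2 : μ[X 0 | 𝒢 0] = fun _ => ∫ ω, X 0 ω ∂μ := condExp_bot (X 0)
    rw [h2, hmean, h1]
    rfl
  | succ j => exact h0 j

/-- The strong law for a stationary sequence of martingale differences in `L^p`, obtained by
truncating the first `n + 1` terms at height `(n + 1) ^ α`. -/
lemma tsum_measure_martingale_ne_top {T : Ω → Ω} (hT : MeasurePreserving T μ μ)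
    {p α η : ℝ} (hp1 : 1 < p) (hp2 : p < 2) (hα : 0 < α) (hα1 : α ≤ 1) (hη : 0 < η)
    {m : Ω → ℝ} (hm : MemLp m (ENNReal.ofReal p) μ)
    (hmd : IsMartingaleDifferenceSeq μ (fun i ω => m (T^[i] ω))) :
    ∑' n : ℕ, ENNReal.ofReal (((n : ℝ) + 1) ^ (α * p - 2)) *
      μ {ω | ∃ k ≤ n + 1, η * ((n : ℝ) + 1) ^ α ≤ |birkhoffSum T m k ω|} ≠ ⊤ := by
  have hmi : Integrable m μ := hm.integrable (by simpa using hp1.le)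
  have hstat : ∀ (φ : ℝ → ℝ), Measurable φ → ∀ i,
      ∫ ω, φ (m (T^[i] ω)) ∂μ = ∫ ω, φ (m ω) ∂μ := by
    intro φ hφ i
    have h := integral_map (hT.iterate i).measurable.aemeasurable (f := fun ω => φ (m ω))
      (by rw [(hT.iterate i).map_eq]
          exact (hφ.comp_aemeasurable hm.aemeasurable).aestronglyMeasurable)
    rw [(hT.iterate i).map_eq] at h
    exact h.symm
  have hXi : ∀ i, Integrable (fun ω => m (T^[i] ω)) μ := fun i =>
    (hT.iterate i).integrable_comp_of_integrable hmi
  obtain ⟨𝒢, hGm, hG0⟩ := hmd.exists_shifted_filtration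
    ((hstat id measurable_id 0).trans (hstat id measurable_id 1).symm)
  let V : ℕ → ℝ := fun n => ∫ ω, (if |m ω| ≤ ((n : ℝ) + 1) ^ α then m ω ^ 2 else 0) ∂μ
  let W : ℕ → ℝ := fun n => ∫ ω, (if |m ω| ≤ ((n : ℝ) + 1) ^ α then 0 else |m ω|) ∂μ
  have hφV : ∀ K : ℝ, Measurable fun x : ℝ => if |x| ≤ K then x ^ 2 else 0 := fun K =>
    Measurable.ite (measurableSet_le (by fun_prop) measurable_const) (by fun_prop)
      measurable_const
  have hφW : ∀ K : ℝ, Measurable fun x : ℝ => if |x| ≤ K then 0 else |x| := fun K =>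
    Measurable.ite (measurableSet_le (by fun_prop) measurable_const) measurable_const
      (by fun_prop)
  have hV : ∀ n, ENNReal.ofReal (V n) ≤
      ∫⁻ ω, ENNReal.ofReal (if |m ω| ≤ ((n : ℝ) + 1) ^ α then m ω ^ 2 else 0) ∂μ := by
    intro n
    refine le_of_eq (ofReal_integral_eq_lintegral_ofReal ?_ ?_)
    · refine Integrable.of_bound (C := (((n : ℝ) + 1) ^ α) ^ 2)
        ((hφV _).comp_aemeasurable hm.aemeasurable).aestronglyMeasurable
        (Filter.Eventually.of_forall fun ω => ?_)
      split_ifs with h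
      · rw [Real.norm_eq_abs, abs_pow]; gcongr
      · simp; positivity
    · refine Filter.Eventually.of_forall fun ω => ?_
      dsimp only [Pi.zero_apply]
      split_ifs <;> positivity
  have hW : ∀ n, ENNReal.ofReal (W n) ≤ ∫⁻ ω, ENNReal.ofReal
      (if 1 * ((n : ℝ) + 1) ^ α ≤ |m ω| then |m ω| ^ (1 : ℝ) else 0) ∂μ := by
    intro n
    rw [ofReal_integral_eq_lintegral_ofReal]
    · refine lintegral_mono fun ω => ENNReal.ofReal_le_ofReal ?_
      rw [one_mul, Real.rpow_one]
      split_ifs <;> first | positivity | linarith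
    · refine hmi.abs.mono' ((hφW _).comp_aemeasurable hm.aemeasurable).aestronglyMeasurable
        (Filter.Eventually.of_forall fun ω => ?_)
      split_ifs <;> simp
    · refine Filter.Eventually.of_forall fun ω => ?_
      dsimp only [Pi.zero_apply]
      split_ifs <;> positivity
  have hsumV := tsum_mul_lintegral_lower_ne_top (μ := μ) (X := m) (a := α * (2 - p)) (γ := α)
    (s := p) (mul_pos hα (by linarith)) (by nlinarith) hα (by linarith)
    (by field_simp; ring) hm
  have hsumW := tsum_mul_lintegral_upper_ne_top (μ := μ) (X := m) (a := α * (p - 1)) (b := 1)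
    (c := 1) (γ := α) (s := p) (mul_pos hα (by linarith)) zero_le_one one_pos hα
    (by field_simp; linarith) hm
  have hfin := ENNReal.add_ne_top.2
    ⟨ENNReal.mul_ne_top (ENNReal.ofReal_ne_top (r := 4 / η ^ 2)) hsumV,
      ENNReal.mul_ne_top (ENNReal.ofReal_ne_top (r := 4 / η)) hsumW⟩
  rw [← ENNReal.tsum_mul_left, ← ENNReal.tsum_mul_left, ← ENNReal.tsum_add] at hfin
  refine ne_top_of_le_ne_top hfin (ENNReal.tsum_le_tsum fun n => ?_)
  have hN : (0 : ℝ) < (n : ℝ) + 1 := by positivity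
  have hl : 0 < η * ((n : ℝ) + 1) ^ α / 2 := by positivity
  have hbound := measure_exists_two_mul_le_abs_sum_range_le (μ := μ) (𝒢 := 𝒢)
    (X := fun i ω => m (T^[i] ω)) hGm hXi hG0 (K := ((n : ℝ) + 1) ^ α) (V := V n) (W := W n) hl
    (fun i => (hstat _ (hφV _) i).le) (fun i => (hstat _ (hφW _) i).le) (n + 1)
  rw [mul_div_cancel₀ _ (two_ne_zero' ℝ)] at hbound
  refine (mul_le_mul_right hbound _).trans ?_
  rw [mul_add]
  refine add_le_add ?_ ?_
  · refine le_trans (le_of_eq ?_) (mul_le_mul_right (mul_le_mul_right (hV n) _) _)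
    rw [← ENNReal.ofReal_mul (by positivity), ← ENNReal.ofReal_mul (by positivity),
      ← ENNReal.ofReal_mul (by positivity)]
    congr 1
    rw [show -(α * (2 - p)) - 1 = α * p - 2 + 1 - (α + α) by ring,
      rpow_add_one_sub hN, Real.rpow_add hN]
    push_cast
    field_simp
    ring
  · refine le_trans (le_of_eq ?_) (mul_le_mul_right (mul_le_mul_right (hW n) _) _)
    rw [← ENNReal.ofReal_mul (by positivity), ← ENNReal.ofReal_mul (by positivity),
      ← ENNReal.ofReal_mul (by positivity)]
    congr 1
    rw [show α * (p - 1) - 1 = α * p - 2 + 1 - α by ring,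
      rpow_add_one_sub hN]
    push_cast
    field_simp
    ring

end Stationary

/-! ### The maximum of a function with small increments along orbits -/

/-- If `a k` is large, then either `a` stays large on the whole window `[k, k + L)`, or the
increments of `a` exceeding `l / (2 * L)` add up to at least `l / 2`: the smaller increments cannot
contribute more than `l / 2` over `L` steps. -/
lemma card_window_le_or_le_sum_increments (a : ℕ → ℝ) {n k L : ℕ} {l : ℝ} (hk : k ≤ n)
    (hL : 0 < L) (hl : 0 < l) (hak : 2 * l ≤ |a k|) :
    (L : ℝ) ≤ ∑ j ∈ Finset.range (n + L), (if l ≤ |a j| then 1 else 0) ∨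
      l / 2 ≤ ∑ j ∈ Finset.range (n + L),
        if l / (2 * L) ≤ |a j - a (j + 1)| then |a j - a (j + 1)| else 0 := by
  have hL' : (0 : ℝ) < L := by exact_mod_cast hL
  set b : ℕ → ℝ := fun j => if l / (2 * L) ≤ |a j - a (j + 1)| then |a j - a (j + 1)| else 0
    with hb
  have hb0 : ∀ j, 0 ≤ b j := by intro j; simp only [hb]; split_ifs <;> positivity
  refine or_iff_not_imp_right.2 fun hsmall => ?_
  rw [not_le] at hsmall
  have hbig : ∀ j ∈ Finset.Ico k (k + L), l ≤ |a j| := by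
    intro j hj
    rw [Finset.mem_Ico] at hj
    have htel : ∑ u ∈ Finset.Ico k j, (a u - a (u + 1)) = a k - a j := by
      rw [← neg_sub (a j) (a k), ← Finset.sum_Ico_sub a hj.1, ← Finset.sum_neg_distrib]
      simp_rw [neg_sub]
    have h1 : |a k - a j| ≤ ∑ u ∈ Finset.Ico k j, (l / (2 * L) + b u) := by
      rw [← htel]
      refine (Finset.abs_sum_le_sum_abs _ _).trans (Finset.sum_le_sum fun u _ => ?_)
      have : 0 ≤ l / (2 * L) := by positivity
      simp only [hb]
      split_ifs <;> linarith
    have h2 : ∑ u ∈ Finset.Ico k j, b u ≤ ∑ u ∈ Finset.range (n + L), b u := by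
      refine Finset.sum_le_sum_of_subset_of_nonneg (fun u hu => ?_) fun u _ _ => hb0 u
      rw [Finset.mem_Ico] at hu
      rw [Finset.mem_range]
      lia
    have h3 : ((Finset.Ico k j).card : ℝ) * (l / (2 * L)) ≤ l / 2 := by
      have : ((Finset.Ico k j).card : ℝ) ≤ L := by
        rw [Nat.card_Ico]; exact_mod_cast (by lia : j - k ≤ L)
      calc ((Finset.Ico k j).card : ℝ) * (l / (2 * L)) ≤ L * (l / (2 * L)) := by gcongr
        _ = l / 2 := by field_simp
    rw [Finset.sum_add_distrib, Finset.sum_const, nsmul_eq_mul] at h1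
    have h4 := abs_sub_abs_le_abs_sub (a k) (a j)
    linarith
  calc (L : ℝ) = ∑ j ∈ Finset.Ico k (k + L), (if l ≤ |a j| then 1 else 0) := by
        rw [Finset.sum_congr rfl fun j hj => if_pos (hbig j hj)]
        simp
    _ ≤ _ := by
        refine Finset.sum_le_sum_of_subset_of_nonneg (fun u hu => ?_)
          fun u _ _ => by split_ifs <;> positivity
        rw [Finset.mem_Ico] at hu
        rw [Finset.mem_range]
        lia

section Iterates

variable {Ω : Type*} [MeasurableSpace Ω] {μ : Measure Ω}

/-- Markov's inequality for a Birkhoff sum of a nonnegative observable. -/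
lemma measure_le_sum_iterate_le {T : Ω → Ω} (hT : MeasurePreserving T μ μ) {X : Ω → ℝ}
    (hX : AEMeasurable X μ) {φ : ℝ → ℝ} (hφ : Measurable φ) (hφ0 : ∀ x, 0 ≤ φ x) {c : ℝ}
    (hc : 0 < c) (N : ℕ) :
    μ {ω | c ≤ ∑ j ∈ Finset.range N, φ (X (T^[j] ω))} ≤
      ENNReal.ofReal (N / c) * ∫⁻ ω, ENNReal.ofReal (φ (X ω)) ∂μ := by
  have hmeas : AEMeasurable (fun ω => ENNReal.ofReal (φ (X ω))) μ :=
    (hφ.comp_aemeasurable hX).ennreal_ofReal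
  have hmeasj : ∀ j, AEMeasurable (fun ω => ENNReal.ofReal (φ (X (T^[j] ω)))) μ := fun j =>
    hmeas.comp_quasiMeasurePreserving (hT.iterate j).quasiMeasurePreserving
  have hint : ∀ j, ∫⁻ ω, ENNReal.ofReal (φ (X (T^[j] ω))) ∂μ =
      ∫⁻ ω, ENNReal.ofReal (φ (X ω)) ∂μ := by
    intro j
    have h := lintegral_map' (f := fun ω => ENNReal.ofReal (φ (X ω)))
      (by rw [(hT.iterate j).map_eq]; exact hmeas) (hT.iterate j).measurable.aemeasurable
    rw [(hT.iterate j).map_eq] at h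
    exact h.symm
  have hset : {ω | c ≤ ∑ j ∈ Finset.range N, φ (X (T^[j] ω))} ⊆
      {ω | ENNReal.ofReal c ≤ ∑ j ∈ Finset.range N, ENNReal.ofReal (φ (X (T^[j] ω)))} := by
    intro ω hω
    rw [Set.mem_ofPred_eq, ← ENNReal.ofReal_sum_of_nonneg fun j _ => hφ0 _]
    exact ENNReal.ofReal_le_ofReal hω
  refine (measure_mono hset).trans ((meas_ge_le_lintegral_div
    (Finset.aemeasurable_fun_sum _ fun j _ => hmeasj j) (by simpa using hc)
    ENNReal.ofReal_ne_top).trans (le_of_eq ?_))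
  rw [lintegral_finsetSum' _ fun j _ => hmeasj j, Finset.sum_congr rfl fun j _ => hint j,
    Finset.sum_const, Finset.card_range, nsmul_eq_mul, ENNReal.ofReal_div_of_pos hc,
    ENNReal.ofReal_natCast, ENNReal.mul_div_right_comm]

lemma measurable_ite_le_abs_rpow (c b : ℝ) :
    Measurable fun x : ℝ => if c ≤ |x| then |x| ^ b else 0 :=
  Measurable.ite (measurableSet_le measurable_const (by fun_prop)) (by fun_prop) measurable_const

lemma measure_exists_two_mul_le_abs_iterate_le {T : Ω → Ω} (hT : MeasurePreserving T μ μ)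
    {g : Ω → ℝ} (hg : AEMeasurable g μ) {l : ℝ} (hl : 0 < l) {L : ℕ} (hL : 0 < L) (n : ℕ) :
    μ {ω | ∃ k ≤ n, 2 * l ≤ |g (T^[k] ω)|} ≤
      ENNReal.ofReal ((n + L : ℕ) / (L : ℝ)) *
        ∫⁻ ω, ENNReal.ofReal (if l ≤ |g ω| then |g ω| ^ (0 : ℝ) else 0) ∂μ +
      ENNReal.ofReal ((n + L : ℕ) / (l / 2)) *
        ∫⁻ ω, ENNReal.ofReal (if l / (2 * L) ≤ |g ω - g (T ω)| then
          |g ω - g (T ω)| ^ (1 : ℝ) else 0) ∂μ := by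
  have hL' : (0 : ℝ) < L := by exact_mod_cast hL
  have hh : AEMeasurable (fun ω => g ω - g (T ω)) μ :=
    hg.sub (hg.comp_quasiMeasurePreserving hT.quasiMeasurePreserving)
  refine le_trans (measure_mono ?_) ((measure_union_le _ _).trans (add_le_add
    (measure_le_sum_iterate_le hT hg (measurable_ite_le_abs_rpow l 0)
      (fun x => by split_ifs <;> positivity) hL' (n + L))
    (measure_le_sum_iterate_le hT hh (measurable_ite_le_abs_rpow (l / (2 * L)) 1)
      (fun x => by split_ifs <;> positivity) (half_pos hl) (n + L))))
  rintro ω ⟨k, hk, hkl⟩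
  have h := card_window_le_or_le_sum_increments (fun j => g (T^[j] ω)) hk hL hl hkl
  simpa only [Set.mem_union, Set.mem_ofPred_eq, Real.rpow_zero, Real.rpow_one,
    Function.iterate_succ_apply'] using h

variable [IsProbabilityMeasure μ] in
/-- The window length is of order `(n + 1) ^ (α * (p - q))`: it is the shortest for which `g ∈ L^q`
suffices, and then the condition on `q` is exactly what makes `g - g ∘ T ∈ L^r` suffice. -/
lemma tsum_measure_iterate_ne_top {T : Ω → Ω} (hT : MeasurePreserving T μ μ)
    {p q r α η : ℝ} (hq : 1 ≤ q) (hqp : q < p) (hpr : p < r) (hr : r < 2)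
    (hqpr : (p - 1) * r / (r - 1) ≤ q) (hα : 0 < α) (hα1 : α ≤ 1) (hη : 0 < η)
    {g : Ω → ℝ} (hg : MemLp g (ENNReal.ofReal q) μ)
    (hgT : MemLp (fun ω => g ω - g (T ω)) (ENNReal.ofReal r) μ) :
    ∑' n : ℕ, ENNReal.ofReal (((n : ℝ) + 1) ^ (α * p - 2)) *
      μ {ω | ∃ k ≤ n + 1, η * ((n : ℝ) + 1) ^ α ≤ |g (T^[k] ω)|} ≠ ⊤ := by
  have hpos : 0 < 1 - p + q := by linarith
  have hexp : 1 + α * (p - 1) / (α * (1 - p + q)) ≤ r := by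
    rw [div_le_iff₀ (by linarith)] at hqpr
    rw [mul_div_mul_left _ _ hα.ne', ← le_sub_iff_add_le', div_le_iff₀ hpos]
    linarith
  have hsumG := tsum_mul_lintegral_upper_ne_top (μ := μ) (X := g) (a := α * q) (b := 0)
    (c := η / 2) (γ := α) (s := q) (by positivity) le_rfl (by positivity) hα
    (by field_simp; simp) hg
  have hsumH := tsum_mul_lintegral_upper_ne_top (μ := μ) (X := fun ω => g ω - g (T ω))
    (a := α * (p - 1)) (b := 1) (c := η / 8) (γ := α * (1 - p + q)) (s := r)
    (mul_pos hα (by linarith)) zero_le_one (by positivity) (by positivity) hexp hgT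
  have hfin := ENNReal.add_ne_top.2
    ⟨ENNReal.mul_ne_top (ENNReal.ofReal_ne_top (r := 2)) hsumG,
      ENNReal.mul_ne_top (ENNReal.ofReal_ne_top (r := 8 / η)) hsumH⟩
  rw [← ENNReal.tsum_mul_left, ← ENNReal.tsum_mul_left, ← ENNReal.tsum_add] at hfin
  refine ne_top_of_le_ne_top hfin (ENNReal.tsum_le_tsum fun n => ?_)
  set N : ℝ := (n : ℝ) + 1 with hNdef
  have hN : 0 < N := by positivity
  have hN1 : 1 ≤ N := by simp [hNdef]
  set β : ℝ := α * (p - q) with hβ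
  have hβ0 : 0 ≤ β := mul_nonneg hα.le (by linarith)
  have hβ1 : β ≤ 1 := by nlinarith
  have hNβ1 : 1 ≤ N ^ β := Real.one_le_rpow hN1 hβ0
  obtain ⟨L, hLdef⟩ : ∃ L : ℕ, L = ⌈N ^ β⌉₊ := ⟨_, rfl⟩
  have hLlow : N ^ β ≤ L := hLdef ▸ Nat.le_ceil _
  have hLup : (L : ℝ) ≤ 2 * N ^ β := by
    have := Nat.ceil_lt_add_one (show 0 ≤ N ^ β by positivity)
    rw [← hLdef] at this
    linarith
  have hLN : (L : ℝ) ≤ N := by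
    have h1 : N ^ β ≤ ((n + 1 : ℕ) : ℝ) := by
      push_cast
      rw [← hNdef]
      simpa using Real.rpow_le_rpow_of_exponent_le hN1 hβ1
    have h2 : L ≤ n + 1 := by rw [hLdef]; exact Nat.ceil_le.2 h1
    have h3 : (L : ℝ) ≤ ((n + 1 : ℕ) : ℝ) := by exact_mod_cast h2
    simpa [hNdef] using h3
  have hL' : (0 : ℝ) < L := by linarith
  have hL : 0 < L := by exact_mod_cast hL'
  have hl : 0 < η * N ^ α / 2 := by positivity
  have hbound := measure_exists_two_mul_le_abs_iterate_le hT hg.aemeasurable hl hL (n + 1)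
  rw [mul_div_cancel₀ _ (two_ne_zero' ℝ)] at hbound
  have hnum : (((n + 1 + L : ℕ)) : ℝ) ≤ 2 * N := by push_cast; rw [← hNdef]; linarith
  refine (mul_le_mul_right hbound _).trans ?_
  rw [mul_add, ← mul_assoc, ← mul_assoc, ← mul_assoc, ← mul_assoc]
  refine add_le_add (mul_le_mul' ?_ ?_) (mul_le_mul' ?_ ?_)
  · rw [← ENNReal.ofReal_mul (by positivity), ← ENNReal.ofReal_mul (by positivity)]
    refine ENNReal.ofReal_le_ofReal ?_
    calc N ^ (α * p - 2) * (((n + 1 + L : ℕ) : ℝ) / L)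
        ≤ N ^ (α * p - 2) * (2 * N / N ^ β) := by gcongr
      _ = 2 * N ^ (α * q - 1) := by
        rw [show α * q - 1 = α * p - 2 + 1 - β by rw [hβ]; ring,
          rpow_add_one_sub hN]
        ring
  · refine lintegral_mono fun ω => ENNReal.ofReal_le_ofReal (le_of_eq ?_)
    rw [show η * N ^ α / 2 = η / 2 * N ^ α by ring]
  · rw [← ENNReal.ofReal_mul (by positivity), ← ENNReal.ofReal_mul (by positivity)]
    refine ENNReal.ofReal_le_ofReal ?_
    calc N ^ (α * p - 2) * (((n + 1 + L : ℕ) : ℝ) / (η * N ^ α / 2 / 2))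
        ≤ N ^ (α * p - 2) * (2 * N / (η * N ^ α / 2 / 2)) := by gcongr
      _ = 8 / η * N ^ (α * (p - 1) - 1) := by
        rw [show α * (p - 1) - 1 = α * p - 2 + 1 - α by ring,
          rpow_add_one_sub hN]
        field_simp
        norm_num
  · refine lintegral_mono fun ω => ENNReal.ofReal_le_ofReal ?_
    -- Rounding up the window length costs a factor `2` in the threshold.
    have hthr : η / 8 * N ^ (α * (1 - p + q)) ≤ η * N ^ α / 2 / (2 * L) := by
      rw [show α * (1 - p + q) = α - β by rw [hβ]; ring, Real.rpow_sub hN]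
      calc η / 8 * (N ^ α / N ^ β) = η * N ^ α / 2 / (2 * (2 * N ^ β)) := by
            field_simp; norm_num
        _ ≤ _ := by gcongr
    split_ifs with h1 h2 h2
    · exact le_rfl
    · exact absurd (hthr.trans h1) h2
    · positivity
    · exact le_rfl

end Iterates

/-! ### The strong law for a martingale difference plus a coboundary -/

lemma le_maxAbsPartialSum_iff {Ω : Type*} {T : Ω → Ω} {f : Ω → ℝ} {n : ℕ} {ω : Ω} {c : ℝ}
    (hc : 0 < c) :
    c ≤ maxAbsPartialSum T f n ω ↔ ∃ k ∈ Finset.Icc 1 n, c ≤ |birkhoffSum T f k ω| := by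
  lift c to NNReal using hc.le
  rw [maxAbsPartialSum, NNReal.coe_le_coe, Finset.le_sup_iff (by exact_mod_cast hc)]
  simp only [← NNReal.coe_le_coe, coe_nnnorm, Real.norm_eq_abs]

lemma birkhoffSum_add_sub_comp {Ω : Type*} (T : Ω → Ω) (m g : Ω → ℝ) (k : ℕ) (ω : Ω) :
    birkhoffSum T (fun ω => m ω + g ω - g (T ω)) k ω =
      birkhoffSum T m k ω + (g ω - g (T^[k] ω)) := by
  induction k with
  | zero => simp
  | succ k ih =>
    rw [birkhoffSum_succ, birkhoffSum_succ, ih, Function.iterate_succ_apply']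
    ring

theorem theorem2p7 {Ω : Type*} [MeasurableSpace Ω] (μ : Measure Ω) [IsProbabilityMeasure μ]
    (T : Ω ≃ᵐ Ω) (hT : MeasurePreserving T μ μ)
    (p q r : ℝ) (hq : 1 ≤ q) (hqp : q < p) (hpr : p < r) (hr : r < 2)
    (hqpr : (p - 1) * r / (r - 1) ≤ q)
    (g : Ω → ℝ) (hg : MemLp g (ENNReal.ofReal q) μ)
    (hgT : MemLp (fun ω => g ω - g (T ω)) (ENNReal.ofReal r) μ)
    (m : Ω → ℝ) (hm : MemLp m (ENNReal.ofReal p) μ)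
    (hmd : IsMartingaleDifferenceSeq μ (fun i ω => m (T^[i] ω))) :
    SatisfiesPStrongLaw μ T p (fun ω => m ω + g ω - g (T ω)) := by
  intro α hα ε hε
  have hα0 : 0 < α := lt_of_lt_of_le (by apply one_div_pos.2; linarith) hα.1
  have h1 := tsum_measure_martingale_ne_top hT (by linarith) (by linarith) hα0 hα.2 (half_pos hε)
    hm hmd
  have h2 := tsum_measure_iterate_ne_top hT hq hqp hpr hr hqpr hα0 hα.2 (η := ε / 4)
    (by positivity) hg hgT
  have hfin := ENNReal.add_ne_top.2 ⟨h1, h2⟩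
  rw [← ENNReal.tsum_add] at hfin
  have key : ∑' n : ℕ, ENNReal.ofReal (((n : ℝ) + 1) ^ (α * p - 2)) *
      μ {ω | ε * ((n : ℝ) + 1) ^ α ≤
        maxAbsPartialSum T (fun ω => m ω + g ω - g (T ω)) (n + 1) ω} ≠ ⊤ := by
    refine ne_top_of_le_ne_top hfin (ENNReal.tsum_le_tsum fun n => ?_)
    rw [← mul_add]
    refine mul_le_mul_right (le_trans (measure_mono ?_) (measure_union_le _ _)) _
    intro ω hω
    have hpos : 0 < ε * ((n : ℝ) + 1) ^ α := by positivity
    obtain ⟨k, hk, hkε⟩ := (le_maxAbsPartialSum_iff hpos).1 hω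
    have hkn : k ≤ n + 1 := (Finset.mem_Icc.1 hk).2
    rw [birkhoffSum_add_sub_comp] at hkε
    have htri := abs_add_le (birkhoffSum T m k ω) (g ω - g (T^[k] ω))
    have htri' := abs_sub (g ω) (g (T^[k] ω))
    by_cases hA : ε / 2 * ((n : ℝ) + 1) ^ α ≤ |birkhoffSum T m k ω|
    · exact Or.inl ⟨k, hkn, hA⟩
    · right
      by_cases hB : ε / 4 * ((n : ℝ) + 1) ^ α ≤ |g ω|
      · exact ⟨0, Nat.zero_le _, hB⟩
      · exact ⟨k, hkn, by linarith⟩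
  refine (ENNReal.summable_toReal key).congr fun n => ?_
  rw [ENNReal.toReal_mul, ENNReal.toReal_ofReal (by positivity), measureReal_def]
  push_cast
  rfl
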